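/- **Theorem (Berk's theorem via curvature).** Let $\mathcal X$ be a finite sample space and $P_0$ a probability distribution on $\mathcal X$. Let $\Theta\subseteq\mathbb R^d$ be measurable and let $\theta\mapsto P_\theta$ be a continuous map from $\Theta$ to the strictly positive probability vectors on $\mathcal X$; $P_0$ need not belong to the model $\{P_\theta:\theta\in\Theta\}$. Write $D(P\|Q)=\sum_x P(x)\log\frac{P(x)}{Q(x)}$. Assume: * $\theta_0\in\operatorname{int}\Theta$ minimizes $\theta\mapsto D(P_0\|P_\theta)$ over $\Theta$, and the minimum is well separated: $\inf_{\theta\in\Theta,\ \|\theta-\theta_0\|\ge\delta}D(P_0\|P_\theta)>D(P_0\|P_{\theta_0})$ for every $\delta>0$ (with $\inf\emptyset=+\infty$); * $\theta\mapsto P_\theta$ is twice continuously differentiable near $\theta_0$, with linearly independent partial derivatives at $\theta_0$, and the Hessian of $\theta\mapsto D(P_0\|P_\theta)$ at $\theta_0$ is positive definite; * the prior $\pi$ is a probability measure on $\Theta$ that has, near $\theta_0$, a positive continuous Lebesgue density. Let $T_{\theta_0}=\operatorname{span}\{\partial_1P_{\theta_0},\dots,\partial_dP_{\theta_0}\}$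 be the tangent space of the model at $P_{\theta_0}$, let the columns of $V$ be a basis of $T_{\theta_0}$, and let $$H^*_{\theta_0}=V^\top\operatorname{diag}(1/P_{\theta_0})\,V$$ be the information metric (the Kullback–Leibler Hessian restricted to $T_{\theta_0}$) in this basis. (For an orthonormal basis this is the compression of $\operatorname{diag}(1/P_{\theta_0})$ to $T_{\theta_0}$; for the basis of partial derivatives it is the Fisher information matrix.) Let $X_1,X_2,\dots$ be i.i.d. from $P_0$ and let $\Pr(\,\cdot\mid X_{1:n})$ be the posterior distribution, $\Pr(d\theta\mid X_{1:n})\propto\prod_{i=1}^nP_\theta(X_i)\,\pi(d\theta)$. 1. For every $R>0$ there are constants $c,C>0$, not depending on $n$, $\varepsilon$ or the data, such that for all $n\ge 0$ and all $0<\varepsilon\le R$ the bound $$\Pr\big(\|\theta-\theta_0\|_2>\varepsilon\mid X_{1:n}\big)\le C\exp\{-c\,n\,\lambda_{\min}(H^*_{\theta_0})\,\varepsilon^2\}$$ holds outside an event of $P_0$-probability at most $C\exp\{-c\,n\,\lambda_{\min}(H^*_{\theta_0})\,\varepsilon^2\}$. If $\Theta$ is bounded, one pair $c,C$ serves for all $\varepsilon>0$.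 2. $\|\theta-\theta_0\|_2=O_p\Big(\sqrt{\frac{\log n}{n\,\lambda_{\min}(H^*_{\theta_0})}}\Big)$ under the joint law of $(X_{1:n},\theta)$ in which $X_{1:n}$ is i.i.d. from $P_0$ and, given $X_{1:n}$, $\theta$ is drawn from the posterior: for every $\delta>0$ there is $M$ such that, for all large $n$, this law gives probability at most $\delta$ to $\|\theta-\theta_0\|_2>M\sqrt{\log n/(n\,\lambda_{\min}(H^*_{\theta_0}))}$. -/

import Mathlib

open MeasureTheory Filter Topology Set

noncomputable section

namespace BerkCurvature

/-- The open probability simplex over a finite sample space. -/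
def openSimplex (𝒳 : Type*) [Fintype 𝒳] : Set (𝒳 → ℝ) :=
  {p | (∀ x, 0 < p x) ∧ ∑ x, p x = 1}

/-- Kullback-Leibler divergence `D(P‖q) = ∑ x, P(x) log (P(x) / q(x))` of a distribution `P` on a
finite space from a strictly positive probability vector `q` (with `0 log 0 = 0`). -/
def kl {𝒳 : Type*} [Fintype 𝒳] [MeasurableSpace 𝒳] (P : Measure 𝒳) (q : 𝒳 → ℝ) : ℝ :=
  ∑ x, P.real {x} * Real.log (P.real {x} / q x)

/-- `θ₀` is the KL-pseudo-true parameter: it minimizes `θ ↦ D(P₀‖p θ)` over `Θ`, and the minimum is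
well separated (automatic for a unique minimizer when `Θ` is compact and `p` is continuous). -/
def IsPseudoTrue {𝒳 : Type*} [Fintype 𝒳] [MeasurableSpace 𝒳] {d : ℕ}
    (P₀ : Measure 𝒳) (p : EuclideanSpace ℝ (Fin d) → 𝒳 → ℝ)
    (Θ : Set (EuclideanSpace ℝ (Fin d))) (θ₀ : EuclideanSpace ℝ (Fin d)) : Prop :=
  θ₀ ∈ Θ ∧ (∀ θ ∈ Θ, kl P₀ (p θ₀) ≤ kl P₀ (p θ)) ∧
    ∀ δ > 0, ∃ η > 0, ∀ θ ∈ Θ, δ ≤ ‖θ - θ₀‖ → kl P₀ (p θ₀) + η ≤ kl P₀ (p θ)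

/-- The tangent space at `p θ₀` of the manifold `{p θ}`: the span of the partial derivatives. -/
def tangentSpace {𝒳 : Type*} [Fintype 𝒳] {d : ℕ}
    (p : EuclideanSpace ℝ (Fin d) → 𝒳 → ℝ) (θ₀ : EuclideanSpace ℝ (Fin d)) :
    Submodule ℝ (𝒳 → ℝ) :=
  (fderiv ℝ p θ₀).range

/-- The columns of `V` form a basis of the tangent space of `{p θ}` at `p θ₀`. As `V` has `d`
columns, such a `V` exists iff `θ ↦ p θ` is an immersion at `θ₀`. -/
def IsTangentBasis {𝒳 : Type*} [Fintype 𝒳] {d : ℕ}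
    (p : EuclideanSpace ℝ (Fin d) → 𝒳 → ℝ) (θ₀ : EuclideanSpace ℝ (Fin d))
    (V : Matrix 𝒳 (Fin d) ℝ) : Prop :=
  LinearIndependent ℝ V.col ∧ Submodule.span ℝ (Set.range V.col) = tangentSpace p θ₀

/-- The information-metric Hessian `Vᵀ diag(1/q) V`: the restriction of the ambient Hessian
`diag(1/q)` of the Kullback-Leibler divergence (the Fisher-Rao metric) to the span of the columns
of `V`. If the columns are the partial derivatives of `p` at `θ₀` and `q = p θ₀`, this is the Fisher
information matrix; if they are orthonormal, it is the compression of `diag(1/q)` to their span. -/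
def infoHessian {𝒳 : Type*} [Fintype 𝒳] [DecidableEq 𝒳] {d : ℕ}
    (q : 𝒳 → ℝ) (V : Matrix 𝒳 (Fin d) ℝ) : Matrix (Fin d) (Fin d) ℝ :=
  V.transpose * Matrix.diagonal (fun x => 1 / q x) * V

/-- The smallest eigenvalue of a real symmetric matrix. -/
def lambdaMin {d : ℕ} (H : Matrix (Fin d) (Fin d) ℝ) : ℝ :=
  sInf (spectrum ℝ H)

/-- Near `θ₀`, the prior `π` has a positive continuous density with respect to Lebesgue measure. -/
def HasPosContDensityNear {d : ℕ} (π : Measure (EuclideanSpace ℝ (Fin d)))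
    (θ₀ : EuclideanSpace ℝ (Fin d)) : Prop :=
  ∃ U : Set (EuclideanSpace ℝ (Fin d)), IsOpen U ∧ θ₀ ∈ U ∧
    ∃ f : EuclideanSpace ℝ (Fin d) → ℝ, ContinuousOn f U ∧ (∀ θ ∈ U, 0 < f θ) ∧
      π.restrict U = (volume.restrict U).withDensity (fun θ => ENNReal.ofReal (f θ))

/-- The likelihood `∏ i, p θ (x i)` of a sample `x`. -/
def likelihood {𝒳 : Type*} {d n : ℕ} (p : EuclideanSpace ℝ (Fin d) → 𝒳 → ℝ)
    (x : Fin n → 𝒳) (θ : EuclideanSpace ℝ (Fin d)) : ℝ :=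
  ∏ i, p θ (x i)

/-- The posterior distribution given the sample `x`, by Bayes' formula: proportional to
likelihood times prior. -/
def posterior {𝒳 : Type*} {d n : ℕ} (π : Measure (EuclideanSpace ℝ (Fin d)))
    (p : EuclideanSpace ℝ (Fin d) → 𝒳 → ℝ) (x : Fin n → 𝒳) :
    Measure (EuclideanSpace ℝ (Fin d)) :=
  (∫⁻ θ, ENNReal.ofReal (likelihood p x θ) ∂π)⁻¹ •
    π.withDensity (fun θ => ENNReal.ofReal (likelihood p x θ))

/-- The law of an i.i.d. sample of size `n` from `P₀`. -/
def sampleLaw {𝒳 : Type*} [MeasurableSpace 𝒳] (P₀ : Measure 𝒳) (n : ℕ) :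
    Measure (Fin n → 𝒳) :=
  Measure.pi (fun _ => P₀)

/-- Exponential posterior tails at rate `lam`, for radii `ε ∈ S`: with constants `c, C > 0` not
depending on `n`, `ε` or the data, the bound `Pr(‖θ - θ₀‖ > ε | X₁, …, Xₙ) ≤ C exp(-c n lam ε²)`
holds outside an event of `P₀ⁿ`-probability at most `C exp(-c n lam ε²)`. -/
def PosteriorTailBound {𝒳 : Type*} [MeasurableSpace 𝒳] {d : ℕ}
    (P₀ : Measure 𝒳) (π : Measure (EuclideanSpace ℝ (Fin d)))
    (p : EuclideanSpace ℝ (Fin d) → 𝒳 → ℝ) (θ₀ : EuclideanSpace ℝ (Fin d))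
    (lam : ℝ) (S : Set ℝ) : Prop :=
  ∃ c > 0, ∃ C > 0, ∀ n : ℕ, ∀ ε ∈ S,
    sampleLaw P₀ n {x | ENNReal.ofReal (C * Real.exp (-(c * n * lam * ε ^ 2))) <
        posterior π p x {θ | ε < ‖θ - θ₀‖}} ≤
      ENNReal.ofReal (C * Real.exp (-(c * n * lam * ε ^ 2)))

/-- `‖θ - θ₀‖ = O_p(r n)` when `X₁, …, Xₙ` are i.i.d. from `P₀` and, given them, `θ` is drawn from
the posterior: for every `δ > 0` there is `M` such that the joint probability of
`‖θ - θ₀‖ > M r n` is at most `δ` for all large `n`. -/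
def PosteriorBigOP {𝒳 : Type*} [MeasurableSpace 𝒳] {d : ℕ}
    (P₀ : Measure 𝒳) (π : Measure (EuclideanSpace ℝ (Fin d)))
    (p : EuclideanSpace ℝ (Fin d) → 𝒳 → ℝ) (θ₀ : EuclideanSpace ℝ (Fin d))
    (r : ℕ → ℝ) : Prop :=
  ∀ δ > 0, ∃ M > 0, ∀ᶠ n in atTop,
    ∫⁻ x, posterior π p x {θ | M * r n < ‖θ - θ₀‖} ∂(sampleLaw P₀ n) ≤ ENNReal.ofReal δ

end BerkCurvature

end

/-!
The likelihood of a sample of size `n` is `exp (-n H(P̂, P_θ))`, where `P̂` is the empirical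
distribution and `H` the cross-entropy, and `H(P₀, P_θ)` differs from `D(P₀‖P_θ)` by a constant.
By Hoeffding's inequality `P̂` is within a small multiple of `ε` of `P₀`, outside an event of
probability `O(exp (-c n ε²))`. On this event, replacing `P₀` by `P̂` perturbs
`θ ↦ H(P₀, P_θ) - H(P₀, P_{θ₀})` near `θ₀` by at most a small multiple of `ε ‖θ - θ₀‖`. The
quadratic growth given by the Hessian therefore survives for `‖θ - θ₀‖ ≥ ε`, while on a ball of
radius a small multiple of `ε` the perturbed function is much smaller than at radius `ε`. Comparing
the integrals of the likelihood over these two regions bounds the posterior tail.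
-/

namespace BerkCurvature

section Calculus

variable {E F : Type*} [NormedAddCommGroup E] [NormedSpace ℝ E] [NormedAddCommGroup F]
  [NormedSpace ℝ F]

theorem isLittleO_taylor_two {f : E → F} {x : E} (hf : ∀ᶠ y in 𝓝 x, DifferentiableAt ℝ f y)
    (hf' : DifferentiableAt ℝ (fderiv ℝ f) x) :
    (fun y => f y - f x - fderiv ℝ f x (y - x) -
      (1 / 2 : ℝ) • fderiv ℝ (fderiv ℝ f) x (y - x) (y - x)) =o[𝓝 x] fun y => ‖y - x‖ ^ 2 := by
  set B := fderiv ℝ (fderiv ℝ f) x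
  have hsymm (v w : E) : B v w = B w v :=
    second_derivative_symmetric_of_eventually (hf.mono fun y hy => hy.hasFDerivAt)
      hf'.hasFDerivAt v w
  obtain ⟨r, hr, hball⟩ := Metric.eventually_nhds_iff_ball.1 hf
  set g := fun y => f y - fderiv ℝ f x (y - x) - (1 / 2 : ℝ) • B (y - x) (y - x)
  have hderiv : ∀ y ∈ Metric.ball x r, HasFDerivWithinAt g
      (fderiv ℝ f y - fderiv ℝ f x - B (y - x)) (Metric.ball x r) y := by
    intro y hy
    have hid : HasFDerivAt (fun y => y - x) (ContinuousLinearMap.id ℝ E) y :=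
      (hasFDerivAt_id y).sub_const x
    have hB := (B.hasFDerivAt.comp y hid).clm_apply hid
    refine ((((hball y hy).hasFDerivAt.sub ((fderiv ℝ f x).hasFDerivAt.comp y hid)).sub
      (hB.const_smul (1 / 2 : ℝ))).congr_fderiv ?_).hasFDerivWithinAt
    ext v
    have hhalf : (1 / 2 : ℝ) • (B (y - x) v + B v (y - x)) = B (y - x) v := by
      rw [hsymm v]; module
    simpa using hhalf
  have hsmall : (fun y => fderiv ℝ f y - fderiv ℝ f x - B (y - x)) =o[𝓝[Metric.ball x r] x]
      fun y => ‖y - x‖ ^ 1 := by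
    simpa only [pow_one] using (hf'.hasFDerivAt.isLittleO.norm_right).mono nhdsWithin_le_nhds
  have := (convex_ball x r).isLittleO_pow_succ (Metric.mem_ball_self hr) hderiv hsmall
  rw [Metric.isOpen_ball.nhdsWithin_eq (Metric.mem_ball_self hr)] at this
  refine this.congr_left fun y => ?_
  simp only [g, sub_self, map_zero, smul_zero, sub_zero]
  abel

theorem isCoercive_of_forall_pos [FiniteDimensional ℝ E] {B : E →L[ℝ] E →L[ℝ] ℝ}
    (hB : ∀ v ≠ 0, 0 < B v v) : IsCoercive B := by
  obtain ⟨c, hc, hcB⟩ := (isCompact_sphere (0 : E) 1).exists_forall_le'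
    (f := fun v => B v v) (by fun_prop)
    fun v hv => hB v (ne_zero_of_mem_unit_sphere ⟨v, hv⟩)
  refine ⟨c, hc, fun v => ?_⟩
  obtain rfl | hv := eq_or_ne v 0
  · simp
  have hv' : 0 < ‖v‖ := norm_pos_iff.2 hv
  have := hcB (‖v‖⁻¹ • v) (by simp [norm_smul, hv'.ne'])
  simp only [map_smul, _root_.smul_apply, smul_eq_mul] at this
  rwa [← mul_assoc, ← mul_inv, inv_mul_eq_div, le_div_iff₀ (by positivity), ← mul_assoc] at this

theorem exists_quadratic_bounds_of_isLocalMin [FiniteDimensional ℝ E] {f : E → ℝ} {x : E}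
    (hf : ContDiffAt ℝ 2 f x) (hmin : IsLocalMin f x)
    (hpos : ∀ v ≠ 0, 0 < iteratedFDeriv ℝ 2 f x ![v, v]) :
    ∃ a > 0, ∃ b > 0, ∀ᶠ y in 𝓝 x,
      a * ‖y - x‖ ^ 2 ≤ f y - f x ∧ f y - f x ≤ b * ‖y - x‖ ^ 2 := by
  set B := fderiv ℝ (fderiv ℝ f) x
  obtain ⟨m, hm, hcoercive⟩ : IsCoercive B :=
    isCoercive_of_forall_pos fun v hv => by simpa [iteratedFDeriv_two_apply] using hpos v hv
  have hdiff : ∀ᶠ y in 𝓝 x, DifferentiableAt ℝ f y :=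
    (hf.eventually (by simp)).mono fun y hy => hy.differentiableAt two_ne_zero
  have hdiff' : DifferentiableAt ℝ (fderiv ℝ f) x :=
    (hf.fderiv_right (m := 1) (by norm_num)).differentiableAt one_ne_zero
  refine ⟨m / 4, by positivity, ‖B‖ + m, by positivity, ?_⟩
  filter_upwards [(isLittleO_taylor_two hdiff hdiff').def (show 0 < m / 4 by positivity)] with y hy
  rw [hmin.fderiv_eq_zero, _root_.zero_apply, sub_zero, smul_eq_mul, norm_pow, norm_norm,
    Real.norm_eq_abs, abs_le] at hy
  have hlower := hcoercive (y - x)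
  have hupper := (le_abs_self _).trans (B.le_opNorm₂ (y - x) (y - x))
  have hB : 0 ≤ ‖B‖ * ‖y - x‖ ^ 2 := by positivity
  constructor <;> nlinarith [hy.1, hy.2, hB, sq_nonneg ‖y - x‖]

end Calculus

section CrossEntropy

theorem exists_one_sub_smul_le_of_abs_sub_le {ι : Type*} [Finite ι] {u : ι → ℝ}
    (hu : 0 ≤ u) {τ : ℝ} (hτ : 0 < τ) :
    ∃ t > 0, ∀ w, 0 ≤ w → (∀ y, |w y - u y| ≤ t) → (1 - τ) • u ≤ w := by
  have hsmall : ∀ᶠ t in 𝓝[>] (0 : ℝ), ∀ y, u y ≠ 0 → t < τ * u y := by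
    refine eventually_all.2 fun y => ?_
    by_cases hy : u y = 0
    · simp [hy]
    · have : 0 < τ * u y := mul_pos hτ ((hu y).lt_of_ne' hy)
      filter_upwards [nhdsWithin_le_nhds (eventually_lt_nhds this)] with t ht _ using ht
  obtain ⟨t, ht, ht₀⟩ := (hsmall.and self_mem_nhdsWithin).exists
  refine ⟨t, ht₀, fun w hw hwu y => ?_⟩
  rw [Pi.smul_apply, smul_eq_mul]
  by_cases hy : u y = 0
  · simpa [hy] using hw y
  · linarith [ht y hy, (abs_le.1 (hwu y)).1]

variable {𝒳 : Type*} [Fintype 𝒳] {w w' q q' : 𝒳 → ℝ} {t : ℝ}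

/-- The cross-entropy `-∑ y, w y * log (q y)` of `q` relative to the weights `w`. Relative to a
distribution it is the Kullback-Leibler divergence up to a constant, and relative to the empirical
frequencies of a sample it is the negative log-likelihood per observation. -/
noncomputable def crossEntropy (w q : 𝒳 → ℝ) : ℝ :=
  ∑ y, w y * -Real.log (q y)

theorem crossEntropy_add (w w' q : 𝒳 → ℝ) :
    crossEntropy (w + w') q = crossEntropy w q + crossEntropy w' q := by
  simp only [crossEntropy, Pi.add_apply, add_mul, Finset.sum_add_distrib]

theorem crossEntropy_smul (c : ℝ) (w q : 𝒳 → ℝ) :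
    crossEntropy (c • w) q = c * crossEntropy w q := by
  simp only [crossEntropy, Pi.smul_apply, smul_eq_mul, mul_assoc, Finset.mul_sum]

theorem neg_log_nonneg_of_mem_openSimplex (hq : q ∈ openSimplex 𝒳) (y : 𝒳) :
    0 ≤ -Real.log (q y) :=
  neg_nonneg.2 <| Real.log_nonpos (hq.1 y).le <|
    hq.2 ▸ Finset.single_le_sum (fun z _ => (hq.1 z).le) (Finset.mem_univ y)

theorem crossEntropy_mono (hw : w ≤ w') (hq : q ∈ openSimplex 𝒳) :
    crossEntropy w q ≤ crossEntropy w' q :=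
  Finset.sum_le_sum fun y _ =>
    mul_le_mul_of_nonneg_right (hw y) (neg_log_nonneg_of_mem_openSimplex hq y)

theorem crossEntropy_nonneg (hw : 0 ≤ w) (hq : q ∈ openSimplex 𝒳) : 0 ≤ crossEntropy w q :=
  Finset.sum_nonneg fun y _ => mul_nonneg (hw y) (neg_log_nonneg_of_mem_openSimplex hq y)

theorem abs_crossEntropy_sub_sub_le (hw : ∀ y, |w y - w' y| ≤ t) (q q' : 𝒳 → ℝ) :
    |(crossEntropy w q - crossEntropy w q') - (crossEntropy w' q - crossEntropy w' q')| ≤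
      t * ∑ y, |Real.log (q y) - Real.log (q' y)| := by
  simp only [crossEntropy, ← Finset.sum_sub_distrib, Finset.mul_sum]
  refine (Finset.abs_sum_le_sum_abs _ _).trans (Finset.sum_le_sum fun y _ => ?_)
  calc |w y * -Real.log (q y) - w y * -Real.log (q' y) -
        (w' y * -Real.log (q y) - w' y * -Real.log (q' y))|
      = |w y - w' y| * |Real.log (q y) - Real.log (q' y)| := by
        rw [← abs_neg (Real.log _ - _), ← abs_mul]; ring_nf
    _ ≤ t * |Real.log (q y) - Real.log (q' y)| := by gcongr; exact hw y

-- As `log q` is not bounded over the simplex, `abs_crossEntropy_sub_sub_le` is of no use here. But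
-- `-log q ≥ 0`, so `(1 - τ) • w' ≤ w` keeps all but a fraction `τ` of the cross-entropy of `q`.
theorem exists_crossEntropy_gap_of_abs_sub_le (hw' : 0 ≤ w') (hq' : q' ∈ openSimplex 𝒳) {η : ℝ}
    (hη : 0 < η) :
    ∃ t > 0, ∀ w, 0 ≤ w → (∀ y, |w y - w' y| ≤ t) → ∀ q ∈ openSimplex 𝒳,
      η ≤ crossEntropy w' q - crossEntropy w' q' →
        η / 2 ≤ crossEntropy w q - crossEntropy w q' := by
  set h := crossEntropy w' q'
  have hh : 0 ≤ h := crossEntropy_nonneg hw' hq'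
  set τ := η / (4 * (h + η))
  have hτ : τ * (h + η) = η / 4 := by simp only [τ]; field_simp
  have hτ₁ : τ ≤ 1 := (div_le_one (by positivity)).2 (by linarith)
  obtain ⟨t₁, ht₁, hlower⟩ := exists_one_sub_smul_le_of_abs_sub_le hw' (show 0 < τ by positivity)
  set A := crossEntropy 1 q'
  have hA : 0 ≤ A := crossEntropy_nonneg zero_le_one hq'
  set t₂ := η / (4 * (A + 1))
  have ht₂A : t₂ * A ≤ η / 4 := by
    calc t₂ * A ≤ t₂ * (A + 1) := by gcongr; linarith
      _ = η / 4 := by simp only [t₂]; field_simp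
  refine ⟨min t₁ t₂, by positivity, fun w hw hww' q hq hgap => ?_⟩
  have hupper : w ≤ w' + t₂ • 1 := fun y => by
    have := (abs_le.1 ((hww' y).trans (min_le_right _ _))).2
    simp only [Pi.add_apply, Pi.smul_apply, Pi.one_apply, smul_eq_mul]
    linarith
  have hCEq : (1 - τ) * (h + η) ≤ crossEntropy w q := by
    calc (1 - τ) * (h + η) ≤ (1 - τ) * crossEntropy w' q :=
          mul_le_mul_of_nonneg_left (by linarith) (by linarith)
      _ = crossEntropy ((1 - τ) • w') q := (crossEntropy_smul _ _ _).symm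
      _ ≤ crossEntropy w q := crossEntropy_mono
          (hlower w hw fun y => (hww' y).trans (min_le_left _ _)) hq
  have hCEq' : crossEntropy w q' ≤ h + t₂ * A := by
    calc crossEntropy w q' ≤ crossEntropy (w' + t₂ • 1) q' := crossEntropy_mono hupper hq'
      _ = h + t₂ * A := by rw [crossEntropy_add, crossEntropy_smul]
  linarith

end CrossEntropy

section KullbackLeibler

variable {𝒳 : Type*} [Fintype 𝒳] {E : Type*} [NormedAddCommGroup E] [NormedSpace ℝ E]
  {p : E → 𝒳 → ℝ} {θ₀ : E}

theorem exists_sum_abs_log_sub_log_le (hp : DifferentiableAt ℝ p θ₀) (hp₀ : ∀ y, p θ₀ y ≠ 0) :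
    ∃ K > 0, ∀ᶠ θ in 𝓝 θ₀, ∑ y, |Real.log (p θ y) - Real.log (p θ₀ y)| ≤ K * ‖θ - θ₀‖ := by
  have hO : (fun θ => ∑ y, |Real.log (p θ y) - Real.log (p θ₀ y)|) =O[𝓝 θ₀] fun θ => θ - θ₀ :=
    Asymptotics.IsBigO.fun_sum (A := fun y θ => |Real.log (p θ y) - Real.log (p θ₀ y)|) fun y _ =>
      ((differentiableAt_pi.1 hp y).log (hp₀ y)).isBigO_sub.abs_left
  obtain ⟨K, hK, hO⟩ := hO.exists_pos
  exact ⟨K, hK, hO.bound.mono fun θ hθ => (le_abs_self _).trans hθ⟩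

variable [MeasurableSpace 𝒳] (P : Measure 𝒳)

theorem kl_sub_kl {q q' : 𝒳 → ℝ} (hq : ∀ y, q y ≠ 0) (hq' : ∀ y, q' y ≠ 0) :
    kl P q - kl P q' =
      crossEntropy (fun y => P.real {y}) q - crossEntropy (fun y => P.real {y}) q' := by
  simp only [kl, crossEntropy, ← Finset.sum_sub_distrib]
  refine Finset.sum_congr rfl fun y _ => ?_
  obtain h | h := eq_or_ne (P.real {y}) 0
  · simp [h]
  · rw [Real.log_div h (hq y), Real.log_div h (hq' y)]
    ring

theorem contDiffAt_kl {n : WithTop ℕ∞} (hp : ContDiffAt ℝ n p θ₀) (hp₀ : ∀ y, p θ₀ y ≠ 0) :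
    ContDiffAt ℝ n (fun θ => kl P (p θ)) θ₀ := by
  unfold kl
  refine ContDiffAt.sum fun y _ => ?_
  obtain h | h := eq_or_ne (P.real {y}) 0
  · simpa [h] using contDiffAt_const
  · exact contDiffAt_const.mul
      ((contDiffAt_const.div (contDiffAt_pi.1 hp y) (hp₀ y)).log (div_ne_zero h (hp₀ y)))

variable {P}

theorem exists_crossEntropy_quadratic_bounds [FiniteDimensional ℝ E] (hp : ContDiffAt ℝ 2 p θ₀)
    (hp₀ : ∀ y, p θ₀ y ≠ 0) (hmin : IsLocalMin (fun θ => kl P (p θ)) θ₀)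
    (hpos : ∀ v ≠ 0, 0 < iteratedFDeriv ℝ 2 (fun θ => kl P (p θ)) θ₀ ![v, v]) :
    ∃ a > 0, ∃ b > 0, ∃ K > 0, ∀ᶠ θ in 𝓝 θ₀, ∀ t ≥ 0, ∀ w : 𝒳 → ℝ,
      (∀ y, |w y - P.real {y}| ≤ t) →
      a * ‖θ - θ₀‖ ^ 2 - t * K * ‖θ - θ₀‖ ≤ crossEntropy w (p θ) - crossEntropy w (p θ₀) ∧
      crossEntropy w (p θ) - crossEntropy w (p θ₀) ≤ b * ‖θ - θ₀‖ ^ 2 + t * K * ‖θ - θ₀‖ := by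
  obtain ⟨a, ha, b, hb, hquad⟩ :=
    exists_quadratic_bounds_of_isLocalMin (contDiffAt_kl P hp hp₀) hmin hpos
  obtain ⟨K, hK, hlip⟩ := exists_sum_abs_log_sub_log_le (hp.differentiableAt two_ne_zero) hp₀
  have hne : ∀ᶠ θ in 𝓝 θ₀, ∀ y, p θ y ≠ 0 := eventually_all.2 fun y =>
    (continuousAt_pi.1 hp.continuousAt y).eventually_ne (hp₀ y)
  refine ⟨a, ha, b, hb, K, hK, ?_⟩
  filter_upwards [hquad, hlip, hne] with θ hquadθ hlipθ hneθ t ht w hw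
  rw [kl_sub_kl P hneθ hp₀] at hquadθ
  have hpert := (abs_crossEntropy_sub_sub_le hw (p θ) (p θ₀)).trans
    (mul_le_mul_of_nonneg_left hlipθ ht)
  rw [abs_le] at hpert
  constructor <;> linarith

end KullbackLeibler

section QuadraticWell

variable {E : Type*} [NormedAddCommGroup E] {G : E → ℝ} {Θ : Set E} {θ₀ : E}

/-- At scale `ε`, the function `G` on `Θ` looks like a well with bottom at `θ₀`: outside the
`ε`-ball it grows quadratically up to radius `r`, beyond which it stays above `η`, while on the
small core of radius `ρ * ε` it stays below a quarter of the height `a * ε ^ 2` reached at radius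
`ε`. Inside the `ε`-ball nothing else is asked of `G`, which leaves room for sampling noise. -/
structure HasQuadraticWell (G : E → ℝ) (Θ : Set E) (θ₀ : E) (a η ρ r ε : ℝ) : Prop where
  le_of_mem_annulus : ∀ θ, ε ≤ ‖θ - θ₀‖ → ‖θ - θ₀‖ < r → a * ‖θ - θ₀‖ ^ 2 ≤ G θ
  le_of_far : ∀ θ ∈ Θ, r ≤ ‖θ - θ₀‖ → η ≤ G θ
  le_on_core : ∀ θ, ‖θ - θ₀‖ ≤ ρ * ε → G θ ≤ a / 4 * ε ^ 2

theorem HasQuadraticWell.of_perturbed_quadratic {a b η r ε : ℝ} (ha : 0 < a) (hb : 0 ≤ b)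
    (hε : 0 ≤ ε) (hcore : a / (8 * (a + b)) * ε < r)
    (hloc : ∀ θ, ‖θ - θ₀‖ < r → a * ‖θ - θ₀‖ ^ 2 - a / 2 * ε * ‖θ - θ₀‖ ≤ G θ ∧
      G θ ≤ b * ‖θ - θ₀‖ ^ 2 + a / 2 * ε * ‖θ - θ₀‖)
    (hfar : ∀ θ ∈ Θ, r ≤ ‖θ - θ₀‖ → η ≤ G θ) :
    HasQuadraticWell G Θ θ₀ (a / 2) η (a / (8 * (a + b))) r ε where
  le_of_mem_annulus θ hθε hθr := by
    have : a / 2 * ε * ‖θ - θ₀‖ ≤ a / 2 * ‖θ - θ₀‖ * ‖θ - θ₀‖ := by gcongr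
    linarith [(hloc θ hθr).1]
  le_of_far := hfar
  le_on_core θ hθ := by
    set ρ := a / (8 * (a + b))
    have hρ : 0 ≤ ρ := by positivity
    have hρab : a * ρ + b * ρ = a / 8 := by simp only [ρ]; field_simp
    have hρ₁ : ρ ≤ 1 / 8 := by
      rw [div_le_div_iff₀ (by positivity) (by norm_num)]; linarith
    calc G θ ≤ b * ‖θ - θ₀‖ ^ 2 + a / 2 * ε * ‖θ - θ₀‖ := (hloc θ (hθ.trans_lt hcore)).2
      _ ≤ b * (ρ * ε) ^ 2 + a / 2 * ε * (ρ * ε) := by gcongr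
      _ = (b * ρ * ρ + a * ρ / 2) * ε ^ 2 := by ring
      _ ≤ a / 2 / 4 * ε ^ 2 := by
        have : b * ρ * ρ ≤ b * ρ * (1 / 8) := by gcongr
        gcongr
        nlinarith [mul_nonneg ha.le hρ]

end QuadraticWell

theorem exists_hasQuadraticWell_crossEntropy {𝒳 : Type*} [Fintype 𝒳] [MeasurableSpace 𝒳] {d : ℕ}
    {P₀ : Measure 𝒳} {Θ : Set (EuclideanSpace ℝ (Fin d))} {p : EuclideanSpace ℝ (Fin d) → 𝒳 → ℝ}
    {θ₀ : EuclideanSpace ℝ (Fin d)} (hp : ∀ θ ∈ Θ, p θ ∈ openSimplex 𝒳)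
    (hθ₀ : IsPseudoTrue P₀ p Θ θ₀) (hθ₀_int : θ₀ ∈ interior Θ) (hp_smooth : ContDiffAt ℝ 2 p θ₀)
    (h_nondeg : ∀ v ≠ 0, 0 < iteratedFDeriv ℝ 2 (fun θ => kl P₀ (p θ)) θ₀ ![v, v])
    {r₀ : ℝ} (hr₀ : 0 < r₀) :
    ∃ a > 0, ∃ η > 0, ∃ ρ > 0, ∃ κ > 0, ∃ r ∈ Ioc 0 r₀, ∃ δ > 0, ρ * δ < r ∧ a * δ ^ 2 ≤ η ∧
      ∀ ε ∈ Ioc 0 δ, ∀ w : 𝒳 → ℝ, 0 ≤ w → (∀ y, |w y - P₀.real {y}| ≤ κ * ε) →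
        HasQuadraticWell (fun θ => crossEntropy w (p θ) - crossEntropy w (p θ₀)) Θ θ₀
          a η ρ r ε := by
  have hq₀ := hp θ₀ hθ₀.1
  have hne (θ) (hθ : θ ∈ Θ) (y) : p θ y ≠ 0 := ((hp θ hθ).1 y).ne'
  have hmin : IsLocalMin (fun θ => kl P₀ (p θ)) θ₀ :=
    mem_of_superset (mem_interior_iff_mem_nhds.1 hθ₀_int) hθ₀.2.1
  obtain ⟨a, ha, b, hb, K, hK, hloc⟩ :=
    exists_crossEntropy_quadratic_bounds hp_smooth (hne θ₀ hθ₀.1) hmin h_nondeg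
  obtain ⟨r₁, hr₁, hball⟩ := Metric.eventually_nhds_iff_ball.1 hloc
  set r := min r₁ r₀
  have hr : 0 < r := lt_min hr₁ hr₀
  obtain ⟨η, hη, hsep⟩ := hθ₀.2.2 r hr
  obtain ⟨t, ht, hgap⟩ := exists_crossEntropy_gap_of_abs_sub_le (w' := fun y => P₀.real {y})
    (fun _ => measureReal_nonneg) hq₀ hη
  set κ := a / (2 * K)
  have hκ : 0 < κ := by positivity
  have hκK : κ * K = a / 2 := by simp only [κ]; field_simp
  set ρ := a / (8 * (a + b))
  have hsmall : ∀ᶠ δ in 𝓝[>] (0 : ℝ), κ * δ < t ∧ ρ * δ < r ∧ a / 2 * δ ^ 2 < η / 2 := by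
    have eventually_lt {f : ℝ → ℝ} {c : ℝ} (hf : Continuous f) (hc : f 0 < c) :
        ∀ᶠ δ in 𝓝[>] (0 : ℝ), f δ < c :=
      nhdsWithin_le_nhds ((hf.tendsto 0).eventually_lt_const hc)
    exact (eventually_lt (by fun_prop) (by simpa)).and
      ((eventually_lt (by fun_prop) (by simpa)).and (eventually_lt (by fun_prop) (by simpa)))
  obtain ⟨δ, ⟨hδt, hδr, hδη⟩, hδ⟩ := (hsmall.and self_mem_nhdsWithin).exists
  refine ⟨a / 2, by positivity, η / 2, by positivity, ρ, by positivity, κ, hκ, r,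
    ⟨hr, min_le_right _ _⟩, δ, hδ, hδr, hδη.le, fun ε hε w hw hwP => ?_⟩
  refine .of_perturbed_quadratic ha hb.le hε.1.le ?_ (fun θ hθ => ?_) fun θ hθ hθr => ?_
  · exact (mul_le_mul_of_nonneg_left hε.2 (by positivity)).trans_lt hδr
  · have := hball θ (mem_ball_iff_norm.2 (hθ.trans_le (min_le_left _ _))) _
      (mul_nonneg hκ.le hε.1.le) w hwP
    rwa [mul_right_comm κ ε K, hκK] at this
  · refine hgap w hw (fun y => ((hwP y).trans ?_).trans hδt.le) _ (hp θ hθ) ?_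
    · exact mul_le_mul_of_nonneg_left hε.2 hκ.le
    · rw [← kl_sub_kl P₀ (hne θ hθ) (hne θ₀ hθ₀.1)]
      linarith [hsep θ hθ hθr]

section Hoeffding

open ProbabilityTheory

variable {Ω : Type*} [MeasurableSpace Ω] {μ : Measure Ω}

theorem measureReal_abs_ge_le_of_hasSubgaussianMGF {X : Ω → ℝ} {c : NNReal}
    (hX : HasSubgaussianMGF X c μ) {u : ℝ} (hu : 0 ≤ u) :
    μ.real {ω | u ≤ |X ω|} ≤ 2 * Real.exp (-u ^ 2 / (2 * c)) := by
  have : {ω | u ≤ |X ω|} = {ω | u ≤ X ω} ∪ {ω | u ≤ (-X) ω} := by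
    ext ω; simp [le_abs]
  rw [this, two_mul]
  exact (measureReal_union_le _ _).trans
    (add_le_add (hX.measure_ge_le hu) (hX.neg.measure_ge_le hu))

theorem measureReal_abs_sum_sub_integral_ge_le {ι : Type*} [Fintype ι] {X : ι → Ω → ℝ}
    (hX : ∀ i, AEMeasurable (X i) μ) (hind : iIndepFun X μ) {a b : ℝ}
    (hab : ∀ i, ∀ᵐ ω ∂μ, X i ω ∈ Icc a b) {u : ℝ} (hu : 0 ≤ u) :
    μ.real {ω | u ≤ |∑ i, (X i ω - μ[X i])|} ≤
      2 * Real.exp (-(2 * u ^ 2 / (Fintype.card ι * (b - a) ^ 2))) := by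
  have := hind.isProbabilityMeasure
  have hind' : iIndepFun (fun i ω => X i ω - μ[X i]) μ :=
    hind.comp (fun i z => z - ∫ ω, X i ω ∂μ) fun _ => measurable_id.sub_const _
  have hsum := HasSubgaussianMGF.sum_of_iIndepFun hind' (s := Finset.univ)
    fun i _ => hasSubgaussianMGF_of_mem_Icc (hX i) (hab i)
  refine (measureReal_abs_ge_le_of_hasSubgaussianMGF hsum hu).trans_eq ?_
  congr 2
  simp only [Finset.sum_const, Finset.card_univ, nsmul_eq_mul, NNReal.coe_mul, NNReal.coe_natCast,
    NNReal.coe_pow, NNReal.coe_div, coe_nnnorm, Real.norm_eq_abs, NNReal.coe_ofNat, div_pow, sq_abs]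
  generalize b - a = t
  ring

end Hoeffding

section Sampling

variable {𝒳 : Type*} {n : ℕ}

/-- The frequency of `y` in the sample `x`; it is `0` for the empty sample. -/
noncomputable def empFreq (x : Fin n → 𝒳) (y : 𝒳) : ℝ :=
  (∑ i, ({y} : Set 𝒳).indicator 1 (x i)) / n

theorem empFreq_nonneg (x : Fin n → 𝒳) : 0 ≤ empFreq x := fun _ =>
  div_nonneg (Finset.sum_nonneg fun _ _ => indicator_nonneg (fun _ _ => zero_le_one) _)
    n.cast_nonneg

theorem natCast_mul_empFreq (x : Fin n → 𝒳) (y : 𝒳) :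
    n * empFreq x y = ∑ i, ({y} : Set 𝒳).indicator 1 (x i) := by
  obtain rfl | hn := n.eq_zero_or_pos
  · simp
  · exact mul_div_cancel₀ _ (by positivity)

theorem natCast_mul_sum_empFreq_mul [Fintype 𝒳] (x : Fin n → 𝒳) (g : 𝒳 → ℝ) :
    n * ∑ y, empFreq x y * g y = ∑ i, g (x i) := by
  classical
  simp_rw [Finset.mul_sum, ← mul_assoc, natCast_mul_empFreq, Finset.sum_mul]
  rw [Finset.sum_comm]
  simp [indicator_apply]

theorem likelihood_eq_exp_crossEntropy [Fintype 𝒳] {d : ℕ} {p : EuclideanSpace ℝ (Fin d) → 𝒳 → ℝ}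
    {θ : EuclideanSpace ℝ (Fin d)} (hθ : ∀ y, 0 < p θ y) (x : Fin n → 𝒳) :
    likelihood p x θ = Real.exp (-(n * crossEntropy (empFreq x) (p θ))) := by
  rw [crossEntropy, natCast_mul_sum_empFreq_mul x fun y => -Real.log (p θ y),
    Finset.sum_neg_distrib, neg_neg, Real.exp_sum]
  exact Finset.prod_congr rfl fun i _ => (Real.exp_log (hθ _)).symm

variable [MeasurableSpace 𝒳] (P₀ : Measure 𝒳) [IsProbabilityMeasure P₀]

instance : IsProbabilityMeasure (sampleLaw P₀ n) :=
  inferInstanceAs (IsProbabilityMeasure (Measure.pi fun _ => P₀))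

theorem sampleLaw_real_abs_sum_sub_integral_ge_le {f : 𝒳 → ℝ} (hf : Measurable f) {a b : ℝ}
    (hab : ∀ y, f y ∈ Icc a b) {u : ℝ} (hu : 0 ≤ u) :
    (sampleLaw P₀ n).real {x | u ≤ |∑ i, (f (x i) - ∫ y, f y ∂P₀)|} ≤
      2 * Real.exp (-(2 * u ^ 2 / (n * (b - a) ^ 2))) := by
  have hmean (i : Fin n) : ∫ x, f (x i) ∂sampleLaw P₀ n = ∫ y, f y ∂P₀ :=
    integral_comp_eval (μ := fun _ => P₀) hf.aestronglyMeasurable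
  have := measureReal_abs_sum_sub_integral_ge_le (μ := sampleLaw P₀ n)
    (X := fun i x => f (x i)) (fun i => (hf.comp (measurable_pi_apply i)).aemeasurable)
    (ProbabilityTheory.iIndepFun_pi (X := fun _ => f) fun _ => hf.aemeasurable)
    (fun i => .of_forall fun x => hab (x i)) hu
  simpa only [hmean, Fintype.card_fin] using this

theorem sampleLaw_real_abs_empFreq_sub_gt_le [MeasurableSingletonClass 𝒳] (y : 𝒳) {t : ℝ}
    (ht : 0 ≤ t) :
    (sampleLaw P₀ n).real {x | t < |empFreq x y - P₀.real {y}|} ≤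
      2 * Real.exp (-(2 * n * t ^ 2)) := by
  have hsum (x : Fin n → 𝒳) : ∑ i, (({y} : Set 𝒳).indicator (1 : 𝒳 → ℝ) (x i) -
      ∫ z, ({y} : Set 𝒳).indicator 1 z ∂P₀) = n * (empFreq x y - P₀.real {y}) := by
    rw [mul_sub, natCast_mul_empFreq, Finset.sum_sub_distrib,
      integral_indicator_one (measurableSet_singleton y)]
    simp
  have hHoeffding := sampleLaw_real_abs_sum_sub_integral_ge_le (n := n) P₀
    (f := ({y} : Set 𝒳).indicator 1) (measurable_one.indicator (measurableSet_singleton y))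
    (a := 0) (b := 1) (fun z => ⟨indicator_nonneg (fun _ _ => zero_le_one) z,
      indicator_le_self' (fun _ _ => zero_le_one) z⟩) (u := n * t) (by positivity)
  simp_rw [hsum, abs_mul, Nat.abs_cast] at hHoeffding
  refine (measureReal_mono fun x (hx : t < _) => ?_).trans (hHoeffding.trans_eq ?_)
  · exact mul_le_mul_of_nonneg_left hx.le n.cast_nonneg
  · obtain rfl | hn := n.eq_zero_or_pos
    · simp
    · congr 2
      field_simp
      norm_num

theorem sampleLaw_exists_abs_empFreq_sub_gt_le [Fintype 𝒳] [MeasurableSingletonClass 𝒳] {t : ℝ}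
    (ht : 0 ≤ t) :
    sampleLaw P₀ n {x | ∃ y, t < |empFreq x y - P₀.real {y}|} ≤
      ENNReal.ofReal (2 * Fintype.card 𝒳 * Real.exp (-(2 * n * t ^ 2))) := by
  rw [ofPred_exists, ← ofReal_measureReal]
  refine ENNReal.ofReal_le_ofReal ((measureReal_iUnion_fintype_le _).trans ?_)
  calc ∑ y, (sampleLaw P₀ n).real {x | t < |empFreq x y - P₀.real {y}|}
      ≤ ∑ _y : 𝒳, 2 * Real.exp (-(2 * n * t ^ 2)) :=
        Finset.sum_le_sum fun y _ => sampleLaw_real_abs_empFreq_sub_gt_le P₀ y ht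
    _ = 2 * Fintype.card 𝒳 * Real.exp (-(2 * n * t ^ 2)) := by
        rw [Finset.sum_const, Finset.card_univ, nsmul_eq_mul]; ring

end Sampling

section Prior

variable {d : ℕ} {π : Measure (EuclideanSpace ℝ (Fin d))} {θ₀ : EuclideanSpace ℝ (Fin d)}

theorem HasPosContDensityNear.exists_restrict_ball_bounds (hπ : HasPosContDensityNear π θ₀) :
    ∃ r > 0, ∃ m > 0, ∃ M > 0,
      ENNReal.ofReal m • volume.restrict (Metric.ball θ₀ r) ≤ π.restrict (Metric.ball θ₀ r) ∧
      π.restrict (Metric.ball θ₀ r) ≤ ENNReal.ofReal M • volume.restrict (Metric.ball θ₀ r) := by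
  obtain ⟨U, hU, hθ₀U, f, hf, hf_pos, hπU⟩ := hπ
  have hf₀ := hf_pos θ₀ hθ₀U
  have hf_cont : ContinuousAt f θ₀ := hf.continuousAt (hU.mem_nhds hθ₀U)
  obtain ⟨r, hr, hball⟩ := Metric.eventually_nhds_iff_ball.1
    (((hf_cont.eventually_const_lt (half_lt_self hf₀)).and
      (hf_cont.eventually_lt_const (lt_two_mul_self hf₀))).and (hU.mem_nhds hθ₀U))
  have hdensity : π.restrict (Metric.ball θ₀ r) =
      (volume.restrict (Metric.ball θ₀ r)).withDensity fun θ => ENNReal.ofReal (f θ) := by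
    rw [← Measure.restrict_restrict_of_subset fun θ hθ => (hball θ hθ).2, hπU,
      restrict_withDensity measurableSet_ball,
      Measure.restrict_restrict_of_subset fun θ hθ => (hball θ hθ).2]
  refine ⟨r, hr, f θ₀ / 2, by positivity, 2 * f θ₀, by positivity, ?_⟩
  rw [hdensity, ← withDensity_const, ← withDensity_const]
  constructor <;> refine withDensity_mono <|
    (ae_restrict_mem measurableSet_ball).mono fun θ hθ => ENNReal.ofReal_le_ofReal ?_
  exacts [(hball θ hθ).1.1.le, (hball θ hθ).1.2.le]

end Prior

section Laplace

theorem HasQuadraticWell.lintegral_far_le {E : Type*} [NormedAddCommGroup E] [MeasurableSpace E]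
    [BorelSpace E] {π : Measure E} [IsProbabilityMeasure π] {G : E → ℝ} {Θ : Set E} {θ₀ : E}
    {a η ρ r ε s : ℝ} (hG : HasQuadraticWell G Θ θ₀ a η ρ r ε)
    (hπΘ : π Θᶜ = 0) (hs : 0 ≤ s) :
    ∫⁻ θ in (Metric.ball θ₀ r)ᶜ, ENNReal.ofReal (Real.exp (-(s * G θ))) ∂π ≤
      ENNReal.ofReal (Real.exp (-(s * η))) := by
  have hΘ : ∀ᵐ θ ∂π, θ ∈ Θ := hπΘ
  calc _ ≤ ∫⁻ _ in (Metric.ball θ₀ r)ᶜ, ENNReal.ofReal (Real.exp (-(s * η))) ∂π := by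
        refine lintegral_mono_ae ?_
        filter_upwards [ae_restrict_mem measurableSet_ball.compl, ae_restrict_of_ae hΘ]
          with θ hθ hθΘ
        rw [mem_compl_iff, mem_ball_iff_norm, not_lt] at hθ
        gcongr
        exact hG.le_of_far θ hθΘ hθ
    _ ≤ ENNReal.ofReal (Real.exp (-(s * η))) := by
        rw [setLIntegral_const]
        exact mul_le_of_le_one_right' prob_le_one

variable {E : Type*} [NormedAddCommGroup E] [InnerProductSpace ℝ E] [FiniteDimensional ℝ E]
  [MeasurableSpace E] [BorelSpace E]

theorem lintegral_exp_neg_mul_sq_norm_sub (θ₀ : E) {b : ℝ} (hb : 0 < b) :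
    ∫⁻ θ, ENNReal.ofReal (Real.exp (-(b * ‖θ - θ₀‖ ^ 2))) =
      ENNReal.ofReal ((Real.pi / b) ^ (Module.finrank ℝ E / 2 : ℝ)) := by
  have hI := GaussianFourier.integral_rexp_neg_mul_sq_norm (V := E) hb
  simp_rw [neg_mul] at hI
  rw [lintegral_sub_right_eq_self (fun θ => ENNReal.ofReal (Real.exp (-(b * ‖θ‖ ^ 2)))) θ₀, ← hI,
    ofReal_integral_eq_lintegral_ofReal _ (.of_forall fun _ => (Real.exp_pos _).le)]
  exact .of_integral_ne_zero (by rw [hI]; positivity)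

theorem lintegral_exp_neg_mul_sq_norm_sub_le (θ₀ : E) {b s ε : ℝ} (hb : 0 < b) (hε : 0 < ε)
    (hs : 1 ≤ s * ε ^ 2) :
    ∫⁻ θ, ENNReal.ofReal (Real.exp (-(s * b * ‖θ - θ₀‖ ^ 2))) ≤
      ENNReal.ofReal ((Real.pi / b) ^ (Module.finrank ℝ E / 2 : ℝ) * ε ^ Module.finrank ℝ E) := by
  have hs₀ : 0 < s := pos_of_mul_pos_left (one_pos.trans_le hs) (by positivity)
  rw [lintegral_exp_neg_mul_sq_norm_sub θ₀ (by positivity)]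
  refine ENNReal.ofReal_le_ofReal ?_
  calc (Real.pi / (s * b)) ^ (Module.finrank ℝ E / 2 : ℝ)
      ≤ (Real.pi / b * ε ^ 2) ^ (Module.finrank ℝ E / 2 : ℝ) := by
        refine Real.rpow_le_rpow (by positivity) ?_ (by positivity)
        rw [div_le_iff₀ (by positivity)]
        calc Real.pi ≤ Real.pi * (s * ε ^ 2) := le_mul_of_one_le_right Real.pi_pos.le hs
          _ = Real.pi / b * ε ^ 2 * (s * b) := by field_simp
    _ = (Real.pi / b) ^ (Module.finrank ℝ E / 2 : ℝ) * ε ^ Module.finrank ℝ E := by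
        rw [Real.mul_rpow (by positivity) (by positivity), ← Real.rpow_natCast ε 2,
          ← Real.rpow_mul hε.le, Nat.cast_ofNat, mul_div_cancel₀ _ two_ne_zero, Real.rpow_natCast]

theorem exp_neg_mul_le_pow (k : ℕ) {s η ε δ : ℝ} (hη : 0 < η) (hε : ε ∈ Ioc 0 δ)
    (hs : 1 ≤ s * ε ^ 2) : Real.exp (-(s * η)) ≤ k.factorial * (δ / η) ^ k * ε ^ k := by
  have hs₀ : 0 < s := pos_of_mul_pos_left (one_pos.trans_le hs) (by positivity)
  have hδ : 0 < δ := hε.1.trans_le hε.2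
  have hsδε : 1 ≤ s * (δ * ε) := by
    refine hs.trans ?_
    rw [sq]
    gcongr
    exacts [hε.1.le, hε.2]
  calc Real.exp (-(s * η)) ≤ k.factorial / (s * η) ^ k := by
        rw [Real.exp_neg, inv_le_comm₀ (Real.exp_pos _) (by positivity), inv_div]
        exact Real.pow_div_factorial_le_exp _ (by positivity) k
    _ ≤ k.factorial / (s * η) ^ k * (s * (δ * ε)) ^ k :=
        le_mul_of_one_le_right (by positivity) (one_le_pow₀ hsδε)
    _ = k.factorial * (δ / η) ^ k * ε ^ k := by
        simp only [mul_pow, div_pow]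
        field_simp

namespace HasQuadraticWell

variable {π : Measure E} {G : E → ℝ} {Θ : Set E} {θ₀ : E} {a η ρ r ε s m M δ : ℝ}

theorem lintegral_annulus_le (hG : HasQuadraticWell G Θ θ₀ a η ρ r ε) (ha : 0 < a) (hM : 0 ≤ M)
    (hπM : π.restrict (Metric.ball θ₀ r) ≤ ENNReal.ofReal M • volume) (hε : 0 < ε)
    (hs : 1 ≤ s * ε ^ 2) :
    ∫⁻ θ in {θ | ε < ‖θ - θ₀‖} ∩ Metric.ball θ₀ r, ENNReal.ofReal (Real.exp (-(s * G θ))) ∂π ≤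
      ENNReal.ofReal (M * (Real.pi / (a / 2)) ^ (Module.finrank ℝ E / 2 : ℝ) *
        ε ^ Module.finrank ℝ E * Real.exp (-(a / 2 * (s * ε ^ 2)))) := by
  have hs₀ : 0 < s := pos_of_mul_pos_left (one_pos.trans_le hs) (by positivity)
  have hle : ∀ θ ∈ {θ | ε < ‖θ - θ₀‖} ∩ Metric.ball θ₀ r, ENNReal.ofReal (Real.exp (-(s * G θ))) ≤
      ENNReal.ofReal (Real.exp (-(a / 2 * (s * ε ^ 2)))) *
        ENNReal.ofReal (Real.exp (-(s * (a / 2) * ‖θ - θ₀‖ ^ 2))) := by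
    intro θ ⟨(hθ : ε < ‖θ - θ₀‖), hθr⟩
    rw [← ENNReal.ofReal_mul (Real.exp_nonneg _), ← Real.exp_add]
    refine ENNReal.ofReal_le_ofReal (Real.exp_le_exp.2 ?_)
    have hGθ : s * (a * ‖θ - θ₀‖ ^ 2) ≤ s * G θ :=
      mul_le_mul_of_nonneg_left (hG.le_of_mem_annulus θ hθ.le (mem_ball_iff_norm.1 hθr)) hs₀.le
    have : s * (a / 2) * ε ^ 2 ≤ s * (a / 2) * ‖θ - θ₀‖ ^ 2 := by gcongr
    linarith
  calc _ ≤ ∫⁻ θ in {θ | ε < ‖θ - θ₀‖} ∩ Metric.ball θ₀ r,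
        ENNReal.ofReal (Real.exp (-(a / 2 * (s * ε ^ 2)))) *
          ENNReal.ofReal (Real.exp (-(s * (a / 2) * ‖θ - θ₀‖ ^ 2))) ∂π :=
        setLIntegral_mono' ((measurableSet_lt measurable_const (by fun_prop)).inter
          measurableSet_ball) hle
    _ ≤ ∫⁻ θ, ENNReal.ofReal (Real.exp (-(a / 2 * (s * ε ^ 2)))) *
          ENNReal.ofReal (Real.exp (-(s * (a / 2) * ‖θ - θ₀‖ ^ 2))) ∂(ENNReal.ofReal M • volume) :=
        lintegral_mono' ((Measure.restrict_mono inter_subset_right le_rfl).trans hπM) le_rfl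
    _ ≤ ENNReal.ofReal M * (ENNReal.ofReal (Real.exp (-(a / 2 * (s * ε ^ 2)))) *
          ENNReal.ofReal ((Real.pi / (a / 2)) ^ (Module.finrank ℝ E / 2 : ℝ) *
            ε ^ Module.finrank ℝ E)) := by
        rw [lintegral_smul_measure, lintegral_const_mul _ (by fun_prop), smul_eq_mul]
        gcongr
        exact lintegral_exp_neg_mul_sq_norm_sub_le θ₀ (by positivity) hε hs
    _ = _ := by
        rw [← ENNReal.ofReal_mul (Real.exp_nonneg _), ← ENNReal.ofReal_mul hM]
        ring_nf

theorem lintegral_tail_le [IsProbabilityMeasure π] (hG : HasQuadraticWell G Θ θ₀ a η ρ r ε)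
    (ha : 0 < a) (hη : 0 < η) (haδ : a * δ ^ 2 ≤ η) (hM : 0 ≤ M)
    (hπM : π.restrict (Metric.ball θ₀ r) ≤ ENNReal.ofReal M • volume) (hπΘ : π Θᶜ = 0)
    (hε : ε ∈ Ioc 0 δ) (hs : 1 ≤ s * ε ^ 2) :
    ∫⁻ θ in {θ | ε < ‖θ - θ₀‖}, ENNReal.ofReal (Real.exp (-(s * G θ))) ∂π ≤
      ENNReal.ofReal ((M * (Real.pi / (a / 2)) ^ (Module.finrank ℝ E / 2 : ℝ) +
        (Module.finrank ℝ E).factorial * (δ / (η / 2)) ^ Module.finrank ℝ E) *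
          ε ^ Module.finrank ℝ E * Real.exp (-(a / 2 * (s * ε ^ 2)))) := by
  have hε₀ := hε.1
  have hδ : 0 < δ := hε₀.trans_le hε.2
  have hs₀ : 0 < s := pos_of_mul_pos_left (one_pos.trans_le hs) (by positivity)
  have hfar : Real.exp (-(s * η)) ≤ (Module.finrank ℝ E).factorial *
      (δ / (η / 2)) ^ Module.finrank ℝ E * ε ^ Module.finrank ℝ E *
        Real.exp (-(a / 2 * (s * ε ^ 2))) := by
    have haε : s * (a * ε ^ 2) ≤ s * η := by
      refine mul_le_mul_of_nonneg_left (le_trans ?_ haδ) hs₀.le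
      gcongr
      exact hε.2
    calc Real.exp (-(s * η)) = Real.exp (-(s * (η / 2))) * Real.exp (-(s * (η / 2))) := by
          rw [← Real.exp_add]; ring_nf
      _ ≤ _ := mul_le_mul (exp_neg_mul_le_pow _ (half_pos hη) hε hs)
          (Real.exp_le_exp.2 (by linarith)) (Real.exp_nonneg _) (by positivity)
  have hsplit : {θ | ε < ‖θ - θ₀‖} ⊆
      ({θ | ε < ‖θ - θ₀‖} ∩ Metric.ball θ₀ r) ∪ (Metric.ball θ₀ r)ᶜ := fun θ hθ => by
    by_cases h : θ ∈ Metric.ball θ₀ r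
    exacts [.inl ⟨hθ, h⟩, .inr h]
  refine (lintegral_mono_set hsplit).trans <| (lintegral_union_le _ _ _).trans <|
    (add_le_add (hG.lintegral_annulus_le ha hM hπM hε₀ hs)
      ((hG.lintegral_far_le hπΘ hs₀.le).trans (ENNReal.ofReal_le_ofReal hfar))).trans_eq ?_
  rw [← ENNReal.ofReal_add (by positivity) (by positivity)]
  ring_nf

theorem le_lintegral (hG : HasQuadraticWell G Θ θ₀ a η ρ r ε) (hm : 0 ≤ m)
    (hπm : ENNReal.ofReal m • volume.restrict (Metric.ball θ₀ r) ≤ π.restrict (Metric.ball θ₀ r))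
    (hρε : 0 ≤ ρ * ε) (hρr : ρ * ε < r) (hs : 0 ≤ s) :
    ENNReal.ofReal (m * ρ ^ Module.finrank ℝ E * volume.real (Metric.ball (0 : E) 1) *
        ε ^ Module.finrank ℝ E * Real.exp (-(a / 4 * (s * ε ^ 2)))) ≤
      ∫⁻ θ, ENNReal.ofReal (Real.exp (-(s * G θ))) ∂π := by
  have hcore : Metric.closedBall θ₀ (ρ * ε) ⊆ Metric.ball θ₀ r :=
    Metric.closedBall_subset_ball hρr
  have hπcore : ENNReal.ofReal m * volume (Metric.closedBall θ₀ (ρ * ε)) ≤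
      π (Metric.closedBall θ₀ (ρ * ε)) := by
    simpa [Measure.restrict_eq_self _ hcore] using hπm (Metric.closedBall θ₀ (ρ * ε))
  calc _ = ENNReal.ofReal (Real.exp (-(a / 4 * (s * ε ^ 2)))) *
        (ENNReal.ofReal m * volume (Metric.closedBall θ₀ (ρ * ε))) := by
        rw [Measure.addHaar_closedBall _ _ hρε, ← ofReal_measureReal measure_ball_lt_top.ne,
          ← ENNReal.ofReal_mul (by positivity), ← ENNReal.ofReal_mul hm,
          ← ENNReal.ofReal_mul (Real.exp_nonneg _), mul_pow]
        ring_nf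
    _ ≤ ENNReal.ofReal (Real.exp (-(a / 4 * (s * ε ^ 2)))) *
        π (Metric.closedBall θ₀ (ρ * ε)) := by gcongr
    _ = ∫⁻ _ in Metric.closedBall θ₀ (ρ * ε),
        ENNReal.ofReal (Real.exp (-(a / 4 * (s * ε ^ 2)))) ∂π := (setLIntegral_const _ _).symm
    _ ≤ ∫⁻ θ in Metric.closedBall θ₀ (ρ * ε), ENNReal.ofReal (Real.exp (-(s * G θ))) ∂π := by
        refine setLIntegral_mono' measurableSet_closedBall fun θ hθ => ?_
        have := mul_le_mul_of_nonneg_left (hG.le_on_core θ (mem_closedBall_iff_norm.1 hθ)) hs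
        exact ENNReal.ofReal_le_ofReal (Real.exp_le_exp.2 (by linarith))
    _ ≤ ∫⁻ θ, ENNReal.ofReal (Real.exp (-(s * G θ))) ∂π := setLIntegral_le_lintegral _ _

end HasQuadraticWell

-- Numerator and denominator are both of order `ε ^ dim E` times an exponential: the powers of `ε`
-- cancel, and so does half of the exponent `a / 2` of the numerator.
theorem exists_inv_lintegral_mul_lintegral_tail_le {π : Measure E} [IsProbabilityMeasure π]
    {Θ : Set E} (hπΘ : π Θᶜ = 0) {θ₀ : E} {a η ρ r δ m M : ℝ} (ha : 0 < a) (hη : 0 < η)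
    (hρ : 0 < ρ) (hδ : 0 < δ) (hρδ : ρ * δ < r) (haδ : a * δ ^ 2 ≤ η) (hm : 0 < m) (hM : 0 < M)
    (hπm : ENNReal.ofReal m • volume.restrict (Metric.ball θ₀ r) ≤ π.restrict (Metric.ball θ₀ r))
    (hπM : π.restrict (Metric.ball θ₀ r) ≤ ENNReal.ofReal M • volume) :
    ∃ C > 0, ∀ ε ∈ Ioc 0 δ, ∀ s, 1 ≤ s * ε ^ 2 → ∀ G, HasQuadraticWell G Θ θ₀ a η ρ r ε →
      (∫⁻ θ, ENNReal.ofReal (Real.exp (-(s * G θ))) ∂π)⁻¹ *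
          ∫⁻ θ in {θ | ε < ‖θ - θ₀‖}, ENNReal.ofReal (Real.exp (-(s * G θ))) ∂π ≤
        ENNReal.ofReal (C * Real.exp (-(a / 4 * (s * ε ^ 2)))) := by
  have hv : 0 < volume.real (Metric.ball (0 : E) 1) :=
    ENNReal.toReal_pos (Metric.measure_ball_pos _ _ one_pos).ne' measure_ball_lt_top.ne
  obtain ⟨K, hK⟩ : ∃ K, K = m * ρ ^ Module.finrank ℝ E * volume.real (Metric.ball (0 : E) 1) :=
    ⟨_, rfl⟩
  obtain ⟨L, hL⟩ : ∃ L, L = M * (Real.pi / (a / 2)) ^ (Module.finrank ℝ E / 2 : ℝ) +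
    (Module.finrank ℝ E).factorial * (δ / (η / 2)) ^ Module.finrank ℝ E := ⟨_, rfl⟩
  have hK₀ : 0 < K := by rw [hK]; positivity
  have hL₀ : 0 < L := by rw [hL]; positivity
  refine ⟨L / K, by positivity, fun ε hε s hs G hG => ?_⟩
  have hε₀ := hε.1
  have hs₀ : 0 < s := pos_of_mul_pos_left (one_pos.trans_le hs) (by positivity)
  have hρε : ρ * ε < r := (mul_le_mul_of_nonneg_left hε.2 hρ.le).trans_lt hρδ
  have hevidence := hG.le_lintegral hm.le hπm (by positivity) hρε hs₀.le
  have htail := hG.lintegral_tail_le ha hη haδ hM.le hπM hπΘ hε hs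
  rw [← hK] at hevidence
  rw [← hL] at htail
  refine (mul_le_mul' (ENNReal.inv_le_inv.2 hevidence) htail).trans_eq ?_
  rw [← ENNReal.ofReal_inv_of_pos (by positivity), ← ENNReal.ofReal_mul (by positivity)]
  congr 1
  have hexp : Real.exp (-(a / 2 * (s * ε ^ 2))) =
      Real.exp (-(a / 4 * (s * ε ^ 2))) * Real.exp (-(a / 4 * (s * ε ^ 2))) := by
    rw [← Real.exp_add]; ring_nf
  rw [hexp]
  field_simp

end Laplace

section Posterior

variable {𝒳 : Type*} {d n : ℕ} (π : Measure (EuclideanSpace ℝ (Fin d)))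
  (p : EuclideanSpace ℝ (Fin d) → 𝒳 → ℝ) (x : Fin n → 𝒳)

theorem posterior_apply {A : Set (EuclideanSpace ℝ (Fin d))} (hA : MeasurableSet A) :
    posterior π p x A = (∫⁻ θ, ENNReal.ofReal (likelihood p x θ) ∂π)⁻¹ *
      ∫⁻ θ in A, ENNReal.ofReal (likelihood p x θ) ∂π := by
  rw [posterior, Measure.smul_apply, withDensity_apply _ hA, smul_eq_mul]

theorem posterior_le_one (A : Set (EuclideanSpace ℝ (Fin d))) : posterior π p x A ≤ 1 := by
  refine (measure_mono (subset_univ A)).trans ?_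
  rw [posterior_apply π p x MeasurableSet.univ, Measure.restrict_univ]
  exact ENNReal.inv_mul_le_one _

theorem posterior_absolutelyContinuous : posterior π p x ≪ π :=
  (withDensity_absolutelyContinuous _ _).smul_left _

variable {π p} in
theorem posterior_apply_eq_exp_crossEntropy [Fintype 𝒳] (hp : ∀ᵐ θ ∂π, ∀ y, 0 < p θ y) (e : ℝ)
    {A : Set (EuclideanSpace ℝ (Fin d))} (hA : MeasurableSet A) :
    posterior π p x A =
      (∫⁻ θ, ENNReal.ofReal (Real.exp (-(n * (crossEntropy (empFreq x) (p θ) - e)))) ∂π)⁻¹ *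
        ∫⁻ θ in A, ENNReal.ofReal (Real.exp (-(n * (crossEntropy (empFreq x) (p θ) - e)))) ∂π := by
  set l := ENNReal.ofReal (Real.exp (-(n * e)))
  have hl : l ≠ 0 := (ENNReal.ofReal_pos.2 (Real.exp_pos _)).ne'
  have hl' : l ≠ ⊤ := ENNReal.ofReal_ne_top
  have hlikelihood : ∀ᵐ θ ∂π, ENNReal.ofReal (likelihood p x θ) =
      l * ENNReal.ofReal (Real.exp (-(n * (crossEntropy (empFreq x) (p θ) - e)))) := by
    filter_upwards [hp] with θ hθ
    rw [likelihood_eq_exp_crossEntropy hθ, ← ENNReal.ofReal_mul (Real.exp_nonneg _),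
      ← Real.exp_add]
    ring_nf
  rw [posterior_apply π p x hA, lintegral_congr_ae hlikelihood,
    lintegral_congr_ae (ae_restrict_of_ae hlikelihood), lintegral_const_mul' _ _ hl',
    lintegral_const_mul' _ _ hl', ENNReal.mul_inv (.inl hl) (.inl hl'), mul_mul_mul_comm,
    ENNReal.inv_mul_cancel hl hl', one_mul]

end Posterior

theorem exists_posterior_le_of_abs_empFreq_sub_le {𝒳 : Type*} [Fintype 𝒳] [MeasurableSpace 𝒳]
    {d : ℕ} {P₀ : Measure 𝒳} {Θ : Set (EuclideanSpace ℝ (Fin d))} {θ₀ : EuclideanSpace ℝ (Fin d)}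
    {π : Measure (EuclideanSpace ℝ (Fin d))} [IsProbabilityMeasure π]
    {p : EuclideanSpace ℝ (Fin d) → 𝒳 → ℝ} (hp : ∀ θ ∈ Θ, p θ ∈ openSimplex 𝒳)
    (hθ₀ : IsPseudoTrue P₀ p Θ θ₀) (hθ₀_int : θ₀ ∈ interior Θ) (hp_smooth : ContDiffAt ℝ 2 p θ₀)
    (h_nondeg : ∀ v ≠ 0, 0 < iteratedFDeriv ℝ 2 (fun θ => kl P₀ (p θ)) θ₀ ![v, v])
    (hπΘ : π Θᶜ = 0) (hπ : HasPosContDensityNear π θ₀) :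
    ∃ δ > (0 : ℝ), ∃ κ > 0, ∃ a > 0, ∃ C > 0, ∀ ε ∈ Ioc 0 δ, ∀ (n : ℕ) (x : Fin n → 𝒳),
      1 ≤ n * ε ^ 2 → (∀ y, |empFreq x y - P₀.real {y}| ≤ κ * ε) →
        posterior π p x {θ | ε < ‖θ - θ₀‖} ≤
          ENNReal.ofReal (C * Real.exp (-(a * (n * ε ^ 2)))) := by
  obtain ⟨r₀, hr₀, m, hm, M, hM, hπm, hπM⟩ := hπ.exists_restrict_ball_bounds
  obtain ⟨a, ha, η, hη, ρ, hρ, κ, hκ, r, hr, δ, hδ, hρδ, haδ, hwell⟩ :=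
    exists_hasQuadraticWell_crossEntropy hp hθ₀ hθ₀_int hp_smooth h_nondeg hr₀
  have hball : Metric.ball θ₀ r ⊆ Metric.ball θ₀ r₀ := Metric.ball_subset_ball hr.2
  have hπm' : ENNReal.ofReal m • volume.restrict (Metric.ball θ₀ r) ≤
      π.restrict (Metric.ball θ₀ r) := by
    have := Measure.restrict_mono_measure hπm (Metric.ball θ₀ r)
    rwa [Measure.restrict_smul, Measure.restrict_restrict_of_subset hball,
      Measure.restrict_restrict_of_subset hball] at this
  have hπM' : π.restrict (Metric.ball θ₀ r) ≤ ENNReal.ofReal M • volume :=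
    (Measure.restrict_mono hball le_rfl).trans <| hπM.trans <| by
      rw [← Measure.restrict_smul]; exact Measure.restrict_le_self
  obtain ⟨C, hC, htail⟩ :=
    exists_inv_lintegral_mul_lintegral_tail_le hπΘ ha hη hρ hδ hρδ haδ hm hM hπm' hπM'
  refine ⟨δ, hδ, κ, hκ, a / 4, by positivity, C, hC, fun ε hε n x hn hx => ?_⟩
  have hp_pos : ∀ᵐ θ ∂π, ∀ y, 0 < p θ y :=
    (show ∀ᵐ θ ∂π, θ ∈ Θ from hπΘ).mono fun θ hθ => (hp θ hθ).1
  rw [posterior_apply_eq_exp_crossEntropy x hp_pos (crossEntropy (empFreq x) (p θ₀))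
    (measurableSet_lt measurable_const (by fun_prop))]
  exact htail ε hε n hn _ (hwell ε hε _ (empFreq_nonneg x) hx)

section TailBound

variable {𝒳 : Type*} [MeasurableSpace 𝒳] {d : ℕ} {P₀ : Measure 𝒳}
  {π : Measure (EuclideanSpace ℝ (Fin d))} {p : EuclideanSpace ℝ (Fin d) → 𝒳 → ℝ}
  {θ₀ : EuclideanSpace ℝ (Fin d)} {lam : ℝ}

-- For `n ε² ≤ 1` the bound is at least `1` once `C ≥ exp b`, hence trivial.
theorem posteriorTailBound_of_one_le_mul_sq [IsProbabilityMeasure P₀] (hlam : 0 < lam) {S : Set ℝ}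
    {b : ℝ} (hb : 0 < b) {C : ℝ} (hC : 0 < C)
    (h : ∀ n : ℕ, ∀ ε ∈ S, 1 ≤ n * ε ^ 2 →
      sampleLaw P₀ n {x | ENNReal.ofReal (C * Real.exp (-(b * (n * ε ^ 2)))) <
          posterior π p x {θ | ε < ‖θ - θ₀‖}} ≤
        ENNReal.ofReal (C * Real.exp (-(b * (n * ε ^ 2))))) :
    PosteriorTailBound P₀ π p θ₀ lam S := by
  refine ⟨b / lam, by positivity, max C (Real.exp b), lt_max_of_lt_left hC, fun n ε hε => ?_⟩
  have hexponent : b / lam * n * lam * ε ^ 2 = b * (n * ε ^ 2) := by field_simp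
  rw [hexponent]
  obtain hn | hn := le_total 1 (n * ε ^ 2)
  · have hle : ENNReal.ofReal (C * Real.exp (-(b * (n * ε ^ 2)))) ≤
        ENNReal.ofReal (max C (Real.exp b) * Real.exp (-(b * (n * ε ^ 2)))) := by
      gcongr
      exact le_max_left _ _
    exact (measure_mono fun x hx => hle.trans_lt hx).trans ((h n ε hε hn).trans hle)
  · refine prob_le_one.trans (ENNReal.one_le_ofReal.2 ?_)
    calc (1 : ℝ) ≤ Real.exp b * Real.exp (-(b * (n * ε ^ 2))) := by
          rw [← Real.exp_add, Real.one_le_exp_iff, ← sub_eq_add_neg, sub_nonneg]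
          exact mul_le_of_le_one_right hb.le hn
      _ ≤ max C (Real.exp b) * Real.exp (-(b * (n * ε ^ 2))) := by
          gcongr
          exact le_max_right _ _

theorem exists_posteriorTailBound [Fintype 𝒳] [MeasurableSingletonClass 𝒳]
    [IsProbabilityMeasure P₀] [IsProbabilityMeasure π] {Θ : Set (EuclideanSpace ℝ (Fin d))}
    (hp : ∀ θ ∈ Θ, p θ ∈ openSimplex 𝒳) (hθ₀ : IsPseudoTrue P₀ p Θ θ₀)
    (hθ₀_int : θ₀ ∈ interior Θ) (hp_smooth : ContDiffAt ℝ 2 p θ₀)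
    (h_nondeg : ∀ v ≠ 0, 0 < iteratedFDeriv ℝ 2 (fun θ => kl P₀ (p θ)) θ₀ ![v, v])
    (hπΘ : π Θᶜ = 0) (hπ : HasPosContDensityNear π θ₀) (hlam : 0 < lam) :
    ∃ δ > 0, PosteriorTailBound P₀ π p θ₀ lam (Ioc 0 δ) := by
  obtain ⟨δ, hδ, κ, hκ, a, ha, C, hC, hposterior⟩ :=
    exists_posterior_le_of_abs_empFreq_sub_le hp hθ₀ hθ₀_int hp_smooth h_nondeg hπΘ hπ
  set b := min a (2 * κ ^ 2)
  set B := max C (2 * Fintype.card 𝒳)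
  have hB : 0 < B := lt_max_of_lt_left hC
  refine ⟨δ, hδ, posteriorTailBound_of_one_le_mul_sq hlam (b := b) (by positivity) hB
    fun n ε hε hn => ?_⟩
  have hbad : {x : Fin n → 𝒳 | ENNReal.ofReal (B * Real.exp (-(b * (n * ε ^ 2)))) <
      posterior π p x {θ | ε < ‖θ - θ₀‖}} ⊆ {x | ∃ y, κ * ε < |empFreq x y - P₀.real {y}|} := by
    intro x hx
    by_contra! hgood
    refine hx.not_ge ((hposterior ε hε n x hn (by simpa using hgood)).trans ?_)
    gcongr
    exacts [le_max_left _ _, min_le_left _ _]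
  refine (measure_mono hbad).trans <|
    (sampleLaw_exists_abs_empFreq_sub_gt_le P₀ (mul_pos hκ hε.1).le).trans ?_
  rw [show 2 * n * (κ * ε) ^ 2 = 2 * κ ^ 2 * (n * ε ^ 2) by ring]
  gcongr
  exacts [le_max_right _ _, min_le_right _ _]

namespace PosteriorTailBound

-- Shrink every radius by a fixed factor: tails only grow, and the factor is absorbed into `c`.
theorem Ioc_of_Ioc {δ : ℝ} (hδ : 0 < δ) (h : PosteriorTailBound P₀ π p θ₀ lam (Ioc 0 δ)) (R : ℝ) :
    PosteriorTailBound P₀ π p θ₀ lam (Ioc 0 R) := by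
  obtain ⟨c, hc, C, hC, h⟩ := h
  set R' := max R δ
  have hR' : 0 < R' := lt_max_of_lt_right hδ
  refine ⟨c * (δ / R') ^ 2, by positivity, C, hC, fun n ε hε => ?_⟩
  have hshrink_le : δ / R' * ε ≤ δ := by
    rw [div_mul_eq_mul_div, div_le_iff₀ hR']
    gcongr
    exact hε.2.trans (le_max_left _ _)
  have hshrink : δ / R' * ε ≤ ε :=
    mul_le_of_le_one_left hε.1.le ((div_le_one hR').2 (le_max_right _ _))
  rw [show c * (δ / R') ^ 2 * n * lam * ε ^ 2 = c * n * lam * (δ / R' * ε) ^ 2 by ring]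
  refine (measure_mono fun x hx => ?_).trans
    (h n (δ / R' * ε) ⟨mul_pos (by positivity) hε.1, hshrink_le⟩)
  exact hx.trans_le (measure_mono fun θ hθ => hshrink.trans_lt hθ)

theorem Ioi_of_isBounded {Θ : Set (EuclideanSpace ℝ (Fin d))}
    (h : ∀ R > 0, PosteriorTailBound P₀ π p θ₀ lam (Ioc 0 R)) (hΘ : Bornology.IsBounded Θ)
    (hπΘ : π Θᶜ = 0) : PosteriorTailBound P₀ π p θ₀ lam (Ioi 0) := by
  obtain ⟨R, hR, hΘR⟩ := hΘ.subset_closedBall_lt 0 θ₀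
  obtain ⟨c, hc, C, hC, h⟩ := h R hR
  refine ⟨c, hc, C, hC, fun n ε hε => ?_⟩
  obtain hεR | hεR := le_or_gt ε R
  · exact h n ε ⟨hε, hεR⟩
  · have htail (x : Fin n → 𝒳) : posterior π p x {θ | ε < ‖θ - θ₀‖} = 0 :=
      posterior_absolutelyContinuous π p x <| measure_mono_null (fun θ hθ hθΘ =>
        (hεR.trans hθ).not_ge (mem_closedBall_iff_norm.1 (hΘR hθΘ))) hπΘ
    simp [htail]

theorem of_subsingleton [Subsingleton (EuclideanSpace ℝ (Fin d))] {S : Set ℝ} (hS : S ⊆ Ioi 0) :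
    PosteriorTailBound P₀ π p θ₀ lam S := by
  refine ⟨1, one_pos, 1, one_pos, fun n ε hε => ?_⟩
  have htail : {θ | ε < ‖θ - θ₀‖} = ∅ :=
    eq_empty_of_forall_notMem fun θ (hθ : ε < ‖θ - θ₀‖) => by
      rw [Subsingleton.elim θ θ₀, sub_self, norm_zero] at hθ
      exact hθ.not_gt (hS hε)
  simp [htail]

end PosteriorTailBound

end TailBound

section Rate

theorem lintegral_le_add_measure_lt {α : Type*} [MeasurableSpace α] {μ : Measure α}
    [IsProbabilityMeasure μ] {f : α → ENNReal} (hf : ∀ x, f x ≤ 1) (t : ENNReal) :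
    ∫⁻ x, f x ∂μ ≤ t + μ {x | t < f x} := by
  set T := toMeasurable μ {x | t < f x}
  calc ∫⁻ x, f x ∂μ ≤ ∫⁻ x, (t + T.indicator 1 x) ∂μ := by
        refine lintegral_mono fun x => ?_
        by_cases hx : t < f x
        · have hxT : x ∈ T := subset_toMeasurable _ _ hx
          rw [indicator_of_mem hxT]
          exact (hf x).trans le_add_self
        · exact (not_lt.1 hx).trans le_self_add
    _ = t + μ {x | t < f x} := by
        rw [lintegral_add_left measurable_const, lintegral_const, measure_univ, mul_one,
          lintegral_indicator_one (measurableSet_toMeasurable _ _), measure_toMeasurable]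

theorem tendsto_sqrt_log_div_natCast_mul (lam : ℝ) :
    Tendsto (fun n : ℕ => Real.sqrt (Real.log n / (n * lam))) atTop (𝓝 0) := by
  have hlog : Tendsto (fun n : ℕ => Real.log n / (n * lam)) atTop (𝓝 0) := by
    simpa [Function.comp_def, div_div] using (Real.isLittleO_log_id_atTop.tendsto_div_nhds_zero.comp
      tendsto_natCast_atTop_atTop).div_const lam
  simpa using hlog.sqrt

variable {𝒳 : Type*} [MeasurableSpace 𝒳] {d : ℕ} {P₀ : Measure 𝒳}
  {π : Measure (EuclideanSpace ℝ (Fin d))} {p : EuclideanSpace ℝ (Fin d) → 𝒳 → ℝ}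
  {θ₀ : EuclideanSpace ℝ (Fin d)} {lam : ℝ}

-- At the radius `ε = √(log n / (c n lam))` the exponential bound equals `C / n`.
theorem PosteriorTailBound.posteriorBigOP [IsProbabilityMeasure P₀] (hlam : 0 < lam)
    {R : ℝ} (hR : 0 < R) (h : PosteriorTailBound P₀ π p θ₀ lam (Ioc 0 R)) :
    PosteriorBigOP P₀ π p θ₀ (fun n => Real.sqrt (Real.log n / (n * lam))) := by
  obtain ⟨c, hc, C, -, h⟩ := h
  refine fun δ hδ => ⟨Real.sqrt (1 / c), by positivity, ?_⟩
  have hradius : Tendsto (fun n : ℕ => Real.sqrt (1 / c) * Real.sqrt (Real.log n / (n * lam)))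
      atTop (𝓝 0) := by
    simpa using (tendsto_sqrt_log_div_natCast_mul lam).const_mul (Real.sqrt (1 / c))
  have hbound : Tendsto (fun n : ℕ => C * (n : ℝ)⁻¹) atTop (𝓝 0) := by
    simpa using (tendsto_inv_atTop_nhds_zero_nat (𝕜 := ℝ)).const_mul C
  filter_upwards [hradius.eventually_le_const hR, hbound.eventually_le_const (half_pos hδ),
    eventually_gt_atTop 1] with n hεR hCn hn
  have hn₀ : (0 : ℝ) < n := by positivity
  have hlog : 0 < Real.log n := Real.log_pos (by exact_mod_cast hn)
  set ε := Real.sqrt (1 / c) * Real.sqrt (Real.log n / (n * lam)) with hε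
  have hexponent : c * n * lam * ε ^ 2 = Real.log n := by
    rw [hε, mul_pow, Real.sq_sqrt (by positivity), Real.sq_sqrt (by positivity)]
    field_simp
  have htail := h n ε ⟨by positivity, hεR⟩
  rw [hexponent, Real.exp_neg, Real.exp_log hn₀] at htail
  calc ∫⁻ x, posterior π p x {θ | ε < ‖θ - θ₀‖} ∂sampleLaw P₀ n
      ≤ ENNReal.ofReal (C * (n : ℝ)⁻¹) + ENNReal.ofReal (C * (n : ℝ)⁻¹) :=
        (lintegral_le_add_measure_lt (fun x => posterior_le_one π p x _) _).trans
          (add_le_add_right htail _)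
    _ ≤ ENNReal.ofReal (δ / 2) + ENNReal.ofReal (δ / 2) := by gcongr
    _ = ENNReal.ofReal δ := by
        rw [← ENNReal.ofReal_add (by positivity) (by positivity), add_halves]

theorem posteriorBigOP_of_subsingleton [Subsingleton (EuclideanSpace ℝ (Fin d))] {r : ℕ → ℝ}
    (hr : 0 ≤ r) : PosteriorBigOP P₀ π p θ₀ r := by
  refine fun δ _ => ⟨1, one_pos, .of_forall fun n => ?_⟩
  have htail : {θ | 1 * r n < ‖θ - θ₀‖} = ∅ :=
    eq_empty_of_forall_notMem fun θ (hθ : 1 * r n < ‖θ - θ₀‖) => by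
      rw [one_mul, Subsingleton.elim θ θ₀, sub_self, norm_zero] at hθ
      exact hθ.not_ge (hr n)
  simp only [htail, measure_empty, lintegral_zero, zero_le]

end Rate

theorem lambdaMin_infoHessian_pos {𝒳 : Type*} [Fintype 𝒳] [DecidableEq 𝒳] {d : ℕ} (hd : 0 < d)
    {q : 𝒳 → ℝ} (hq : ∀ y, 0 < q y) {V : Matrix 𝒳 (Fin d) ℝ} (hV : LinearIndependent ℝ V.col) :
    0 < lambdaMin (infoHessian q V) := by
  have : Nonempty (Fin d) := ⟨⟨0, hd⟩⟩
  have hposDef : (infoHessian q V).PosDef := by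
    have := (Matrix.PosDef.diagonal (d := fun y => 1 / q y)
      fun y => one_div_pos.2 (hq y)).conjTranspose_mul_mul_same (Matrix.mulVec_injective_iff.2 hV)
    rwa [Matrix.conjTranspose_eq_transpose_of_trivial] at this
  rw [lambdaMin, hposDef.1.spectrum_real_eq_range_eigenvalues]
  obtain ⟨i, hi⟩ := (range_nonempty hposDef.1.eigenvalues).csInf_mem (finite_range _)
  rw [← hi]
  exact hposDef.eigenvalues_pos i

end BerkCurvature

theorem mainTheorem6_general {𝒳 : Type*} [Fintype 𝒳] [MeasurableSpace 𝒳]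
    [MeasurableSingletonClass 𝒳] {d : ℕ}
    (P₀ : Measure 𝒳) [IsProbabilityMeasure P₀] (Θ : Set (EuclideanSpace ℝ (Fin d)))
    (p : EuclideanSpace ℝ (Fin d) → 𝒳 → ℝ) (hp : ∀ θ ∈ Θ, p θ ∈ BerkCurvature.openSimplex 𝒳)
    (θ₀ : EuclideanSpace ℝ (Fin d)) (hθ₀ : BerkCurvature.IsPseudoTrue P₀ p Θ θ₀)
    (hθ₀_int : θ₀ ∈ interior Θ) (hp_smooth : ContDiffAt ℝ 2 p θ₀)
    (h_nondeg : ∀ v : EuclideanSpace ℝ (Fin d), v ≠ 0 →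
      0 < iteratedFDeriv ℝ 2 (fun θ => BerkCurvature.kl P₀ (p θ)) θ₀ ![v, v])
    (π : Measure (EuclideanSpace ℝ (Fin d))) [IsProbabilityMeasure π]
    (hπ_supp : π Θᶜ = 0) (hπ : BerkCurvature.HasPosContDensityNear π θ₀)
    {lam : ℝ} (hlam : 0 < d → 0 < lam) :
    (∀ R > 0, BerkCurvature.PosteriorTailBound P₀ π p θ₀ lam (Ioc 0 R)) ∧
    (Bornology.IsBounded Θ → BerkCurvature.PosteriorTailBound P₀ π p θ₀ lam (Ioi 0)) ∧
    BerkCurvature.PosteriorBigOP P₀ π p θ₀ (fun n => Real.sqrt (Real.log n / (n * lam))) := by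
  obtain rfl | hd := d.eq_zero_or_pos
  · exact ⟨fun _ _ => .of_subsingleton Ioc_subset_Ioi_self, fun _ => .of_subsingleton le_rfl,
      BerkCurvature.posteriorBigOP_of_subsingleton fun _ => Real.sqrt_nonneg _⟩
  · obtain ⟨δ, hδ, htail⟩ := BerkCurvature.exists_posteriorTailBound hp hθ₀ hθ₀_int hp_smooth
      h_nondeg hπ_supp hπ (hlam hd)
    have htails R (_ : R > 0) := htail.Ioc_of_Ioc hδ R
    exact ⟨htails, fun hΘ => .Ioi_of_isBounded htails hΘ hπ_supp,
      htail.posteriorBigOP (hlam hd) hδ⟩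

theorem mainTheorem6 {𝒳 : Type*} [Fintype 𝒳] [DecidableEq 𝒳] [MeasurableSpace 𝒳]
    [MeasurableSingletonClass 𝒳] {d : ℕ}
    (P₀ : Measure 𝒳) [IsProbabilityMeasure P₀]
    (Θ : Set (EuclideanSpace ℝ (Fin d))) (hΘ : MeasurableSet Θ)
    (p : EuclideanSpace ℝ (Fin d) → 𝒳 → ℝ)
    (hp : ∀ θ ∈ Θ, p θ ∈ BerkCurvature.openSimplex 𝒳)
    (hp_cont : ContinuousOn p Θ)
    (θ₀ : EuclideanSpace ℝ (Fin d))
    (hθ₀ : BerkCurvature.IsPseudoTrue P₀ p Θ θ₀)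
    (hθ₀_int : θ₀ ∈ interior Θ)
    (hp_smooth : ContDiffAt ℝ 2 p θ₀)
    (h_nondeg : ∀ v : EuclideanSpace ℝ (Fin d), v ≠ 0 →
      0 < iteratedFDeriv ℝ 2 (fun θ => BerkCurvature.kl P₀ (p θ)) θ₀ ![v, v])
    (V : Matrix 𝒳 (Fin d) ℝ) (hV : BerkCurvature.IsTangentBasis p θ₀ V)
    (π : Measure (EuclideanSpace ℝ (Fin d))) [IsProbabilityMeasure π]
    (hπ_supp : π Θᶜ = 0) (hπ : BerkCurvature.HasPosContDensityNear π θ₀) :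
    (∀ R > 0, BerkCurvature.PosteriorTailBound P₀ π p θ₀
      (BerkCurvature.lambdaMin (BerkCurvature.infoHessian (p θ₀) V)) (Ioc 0 R)) ∧
    (Bornology.IsBounded Θ → BerkCurvature.PosteriorTailBound P₀ π p θ₀
      (BerkCurvature.lambdaMin (BerkCurvature.infoHessian (p θ₀) V)) (Ioi 0)) ∧
    BerkCurvature.PosteriorBigOP P₀ π p θ₀ (fun n => Real.sqrt (Real.log n /
      (n * BerkCurvature.lambdaMin (BerkCurvature.infoHessian (p θ₀) V)))) := by
  exact mainTheorem6_general P₀ Θ p hp θ₀ hθ₀ hθ₀_int hp_smooth h_nondeg π hπ_supp hπ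
    fun hd => BerkCurvature.lambdaMin_infoHessian_pos hd (hp θ₀ hθ₀.1).1 hV.1
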